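/- Let $s,t,q$ be variables. A nonzero polynomial $p(q)=\sum_i a_iq^i\in\mathbb C[q]$ has total degree $d$ if $d$ is the sum of the largest and the smallest exponent occurring in it, and it is palindromic if $a_i=a_{d-i}$ for $0\le i\le d$; such a $p$ has a unique expansion $p(q)=\sum_{0\le j\le d/2}\gamma_j\,q^j(1+q)^{d-2j}$ with $\gamma_j\in\mathbb C$, and one puts $\Gamma(p)=\sum_{0\le j\le d/2}\gamma_j\,s^{d-2j}(-t)^j\in\mathbb C[s,t]$. For $n\ge 2$ the cyclotomic polynomial $\Phi_n(q)$ is palindromic; the Lucas atoms are $P_1(s,t)=1$ and $P_n(s,t)=\Gamma(\Phi_n(q))$ for $n\ge2$. For a nonzero polynomial $f(s,t)$ let $\operatorname{sdeg} f$ denote the largest power of $s$ occurring in $f$, and let $\phi$ be Euler's totient function. **Theorem.** If $n\ge 5$ is square-free and satisfies $n\equiv 1\pmod 4$, then there are nonzero polynomials $E_n(s,t),F_n(s,t)\in\mathbb Z[s,t]$ such that $$4P_n(s,t)=E_n(s,t)^2-n\,t^2F_n(s,t)^2,$$ $$\operatorname{sdeg}E_n(s,t)=\frac{\phi(n)}2\quad\text{and}\quad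 \operatorname{sdeg}F_n(s,t)=\frac{\phi(n)}2-2.$$ -/

import Mathlib

namespace LucasAtoms

/-- The total degree of a one-variable polynomial: its degree plus its minimum degree
(the smallest exponent that occurs). -/
noncomputable def tdeg (p : Polynomial ℂ) : ℕ := p.natDegree + p.natTrailingDegree

/-- `p = ∑ a_i q^i` of total degree `d` is palindromic if `a_i = a_{d-i}` for all `0 ≤ i ≤ d`.
(The zero polynomial is counted as palindromic.) -/
def IsPalindromic (p : Polynomial ℂ) : Prop :=
  ∀ i ≤ tdeg p, p.coeff i = p.coeff (tdeg p - i)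

/-- The gamma coefficients `γ_0, γ_1, …, γ_{⌊d/2⌋}` of a palindromic polynomial `p` of total
degree `d`, that is, the scalars with `p = ∑_j γ_j q^j (1+q)^{d-2j}`: comparing the coefficients
of `q^j` on both sides computes them recursively. That they satisfy the expansion, and are the
only scalars that do, is shown in `gamma_expansion` and `gamma_expansion_unique`. -/
noncomputable def gammaCoeff (p : Polynomial ℂ) (j : ℕ) : ℂ :=
  p.coeff j - ∑ i : Fin j, gammaCoeff p i * ((tdeg p - 2 * (i : ℕ)).choose (j - i) : ℂ)
termination_by j
decreasing_by exact i.2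

theorem coeff_basis (d j k : ℕ) :
    ((Polynomial.X : Polynomial ℂ) ^ j * (1 + Polynomial.X) ^ (d - 2 * j)).coeff k
      = if j ≤ k then ((d - 2 * j).choose (k - j) : ℂ) else 0 := by
  rw [Polynomial.coeff_X_pow_mul', Polynomial.coeff_one_add_X_pow]

/-- The coefficient of `q^k` in a gamma expansion, for `k` up to the centre of symmetry. -/
theorem coeff_expansion (d k : ℕ) (hk : k ≤ d / 2) (γ : ℕ → ℂ) :
    (∑ j ∈ Finset.range (d / 2 + 1), Polynomial.C (γ j) *
        (Polynomial.X ^ j * (1 + Polynomial.X) ^ (d - 2 * j))).coeff k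
      = γ k + ∑ i : Fin k, γ i * ((d - 2 * (i : ℕ)).choose (k - i) : ℂ) := by
  rw [Polynomial.finsetSum_coeff]
  simp only [Polynomial.coeff_C_mul, coeff_basis]
  rw [Fin.sum_univ_eq_sum_range (fun i => γ i * ((d - 2 * i).choose (k - i) : ℂ)) k,
    ← Finset.sum_subset (Finset.range_mono (Nat.succ_le_succ hk)), Finset.sum_range_succ, add_comm]
  · congr 1
    · simp
    · refine Finset.sum_congr rfl fun j hj => ?_
      rw [if_pos (Finset.mem_range.1 hj).le]
  · intro j _ hj
    rw [Finset.mem_range] at hj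
    rw [if_neg (by omega), mul_zero]

/-- Every palindromic polynomial has a gamma expansion. -/
theorem gamma_expansion (p : Polynomial ℂ) (hp : IsPalindromic p) :
    p = ∑ j ∈ Finset.range (tdeg p / 2 + 1), Polynomial.C (gammaCoeff p j) *
      (Polynomial.X ^ j * (1 + Polynomial.X) ^ (tdeg p - 2 * j)) := by
  have low : ∀ k ≤ tdeg p / 2, p.coeff k =
      (∑ j ∈ Finset.range (tdeg p / 2 + 1), Polynomial.C (gammaCoeff p j) *
        (Polynomial.X ^ j * (1 + Polynomial.X) ^ (tdeg p - 2 * j))).coeff k := by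
    intro k hk
    rw [coeff_expansion _ _ hk]
    conv_rhs => rw [gammaCoeff]
    ring
  ext k
  by_cases hk : k ≤ tdeg p / 2
  · exact low k hk
  by_cases hk' : k ≤ tdeg p
  · rw [hp k hk', low _ (by omega), Polynomial.finsetSum_coeff, Polynomial.finsetSum_coeff]
    refine Finset.sum_congr rfl fun j hj => ?_
    have hj' := Finset.mem_range.1 hj
    rw [Polynomial.coeff_C_mul, Polynomial.coeff_C_mul, coeff_basis, coeff_basis,
      if_pos (by omega : j ≤ k)]
    by_cases h : j ≤ tdeg p - k
    · rw [if_pos h, ← Nat.choose_symm (by omega : k - j ≤ tdeg p - 2 * j),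
        (by omega : tdeg p - 2 * j - (k - j) = tdeg p - k - j)]
    · rw [if_neg h, Nat.choose_eq_zero_of_lt (by omega)]
      simp
  · rw [Polynomial.coeff_eq_zero_of_natDegree_lt (by unfold tdeg at hk'; omega),
      Polynomial.finsetSum_coeff]
    symm
    refine Finset.sum_eq_zero fun j hj => ?_
    have hj' := Finset.mem_range.1 hj
    rw [Polynomial.coeff_C_mul, coeff_basis, if_pos (by omega),
      Nat.choose_eq_zero_of_lt (by omega)]
    simp

/-- The gamma coefficients of a polynomial are determined by its gamma expansion. -/
theorem gamma_expansion_unique (p : Polynomial ℂ) (γ : ℕ → ℂ)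
    (h : p = ∑ j ∈ Finset.range (tdeg p / 2 + 1), Polynomial.C (γ j) *
      (Polynomial.X ^ j * (1 + Polynomial.X) ^ (tdeg p - 2 * j))) :
    ∀ j ≤ tdeg p / 2, γ j = gammaCoeff p j := by
  intro j
  induction j using Nat.strong_induction_on with
  | _ j ih =>
    intro hj
    have h1 : p.coeff j =
        γ j + ∑ i : Fin j, γ i * ((tdeg p - 2 * (i : ℕ)).choose (j - i) : ℂ) := by
      rw [← coeff_expansion _ _ hj γ, ← h]
    rw [gammaCoeff, h1, eq_sub_iff_add_eq]
    congr 1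
    refine Finset.sum_congr rfl fun i _ => ?_
    rw [ih i i.2 (i.2.le.trans hj)]

/-- The Gamma map: a palindromic polynomial `∑_j γ_j q^j (1+q)^{d-2j}` of total degree `d` is
sent to `∑_j γ_j s^{d-2j} (-t)^j` in `ℂ[s,t]`, where `s = X 0` and `t = X 1`. (Only the values at
palindromic polynomials are meaningful.) -/
noncomputable def gammaMap (p : Polynomial ℂ) : MvPolynomial (Fin 2) ℂ :=
  ∑ j ∈ Finset.range (tdeg p / 2 + 1), MvPolynomial.C (gammaCoeff p j) *
    (MvPolynomial.X 0 ^ (tdeg p - 2 * j) * (-MvPolynomial.X 1) ^ j)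

/-- For `n ≥ 2` the cyclotomic polynomial `Φ_n` is palindromic, so that the Gamma map
applies to it. -/
theorem isPalindromic_cyclotomic (n : ℕ) (hn : 2 ≤ n) :
    IsPalindromic (Polynomial.cyclotomic n ℂ) := by
  have hpos : 0 < n := by omega
  have h0 : (Polynomial.cyclotomic n ℤ).coeff 0 = 1 :=
    Polynomial.cyclotomic_coeff_zero ℤ (by omega)
  have hz := Complex.isPrimitiveRoot_exp n hpos.ne'
  have hz' := hz.inv
  have hdvd : Polynomial.cyclotomic n ℤ ∣ (Polynomial.cyclotomic n ℤ).reverse := by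
    rw [Polynomial.cyclotomic_eq_minpoly hz' hpos]
    refine minpoly.isIntegrallyClosed_dvd (hz'.isIntegral hpos) ?_
    rw [← Polynomial.cyclotomic_eq_minpoly hz' hpos]
    let _ := invertibleOfNonzero (hz.ne_zero hpos.ne')
    have h := (Polynomial.eval₂_reverse_eq_zero_iff (algebraMap ℤ ℂ)
      (Complex.exp (2 * Real.pi * Complex.I / n)) (Polynomial.cyclotomic n ℤ)).2 (by
        rw [Polynomial.cyclotomic_eq_minpoly hz hpos]
        exact minpoly.aeval ℤ _)
    rwa [invOf_eq_inv] at h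
  have hmonic : (Polynomial.cyclotomic n ℤ).reverse.Monic := by
    rw [Polynomial.Monic, Polynomial.reverse_leadingCoeff, Polynomial.trailingCoeff_eq_coeff_zero]
    · exact h0
    · rw [h0]; exact one_ne_zero
  have hrev : (Polynomial.cyclotomic n ℤ).reverse = Polynomial.cyclotomic n ℤ :=
    Polynomial.eq_of_monic_of_dvd_of_natDegree_le (Polynomial.cyclotomic.monic n ℤ) hmonic hdvd
      (Polynomial.reverse_natDegree_le _)
  have ht : tdeg (Polynomial.cyclotomic n ℂ) = (Polynomial.cyclotomic n ℤ).natDegree := by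
    rw [tdeg, Polynomial.natTrailingDegree_eq_zero.2 (Or.inr ?_), Polynomial.natDegree_cyclotomic,
      Polynomial.natDegree_cyclotomic, add_zero]
    rw [Polynomial.cyclotomic_coeff_zero ℂ (by omega)]
    exact one_ne_zero
  intro i hi
  rw [ht] at hi ⊢
  rw [← Polynomial.map_cyclotomic_int, Polynomial.coeff_map, Polynomial.coeff_map]
  conv_lhs => rw [← hrev, Polynomial.coeff_reverse, Polynomial.revAt_le hi]

/-- The Lucas atoms: `P_1 = 1` and `P_n = Γ(Φ_n)` for `n ≥ 2`. -/
noncomputable def lucasAtom (n : ℕ) : MvPolynomial (Fin 2) ℂ :=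
  if n = 1 then 1 else gammaMap (Polynomial.cyclotomic n ℂ)

/-- The largest power of `s = X 0` in a nonzero polynomial in `s` and `t`. -/
noncomputable def sdeg {R : Type*} [CommSemiring R] (f : MvPolynomial (Fin 2) R) : ℕ :=
  f.degreeOf 0

end LucasAtoms

/-!
The classical source of the identity is Gauss's formula `4 Φ_n = A² - n q² B²`. Let `χ` be the
Jacobi symbol modulo `n`, a primitive even quadratic character, let `ζ` be a primitive `n`-th root
of unity and `g` the Gauss sum of `χ`, so that `g² = n`
(`gaussSum_sq_of_isPrimitive_of_isQuadratic`). Then `Φ_n = P Q`, where `P` and `Q` collect the roots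
`ζ ^ a` with `χ a = 1` and with `χ a = -1` (`charFactor`), and `4 Φ_n = (P + Q)² - (P - Q)²`.
A Galois automorphism `ζ ↦ ζ ^ u` fixes `P`, `Q` and `g` if `χ u = 1`; if `χ u = -1` it exchanges
`P` with `Q` and negates `g`. Hence `A = P + Q` and `D = (P - Q) / g` have rational coefficients.
Those of `A` are algebraic integers, and so are `n` times the squares of those of `D`; as `n` is
square-free, both polynomials are integral. Since `χ` is even, `P` and `Q` are palindromic with
constant coefficient `1`, so that `A` is palindromic of degree `φ(n)/2` and `D = q B`; the
coefficient of index `φ(n)/2 - 1` in `P - Q` is `-g`, so that `B` is palindromic of degree exactly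
`φ(n)/2 - 2` (`exists_four_mul_cyclotomic_eq`).

The formula is transported to `s` and `t` with `E = Γ(A)` and `F = Γ(B)`. If `p` has total degree
`d`, then `Γ(p)` takes the value `x^d p(q)` at `s = x (1 + q)`, `t = -x² q` (`eval_gammaMap`), and
these points determine a polynomial in `s` and `t` (`eq_of_eval_eq`). The gamma coefficients of an
integral polynomial are integers, and the leading one is its constant coefficient, which gives the
degrees in `s`.
-/

open Polynomial

/-! ### The Jacobi symbol as a primitive character -/

/-- The Jacobi symbol `a ↦ J(a | n)` as a Dirichlet character modulo `n`. -/
def jacobiCharacter (R : Type*) [CommRing R] (n : ℕ) [NeZero n] : DirichletCharacter R n where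
  toFun a := ((jacobiSym a.val n : ℤ) : R)
  map_one' := by
    rw [show jacobiSym ((1 : ZMod n).val : ℤ) n = jacobiSym 1 n from
      jacobiSym.mod_left' (by rw [ZMod.val_one_eq_one_mod]; push_cast; exact Int.emod_emod _ _)]
    simp
  map_mul' a b := by
    rw [← Int.cast_mul, ← jacobiSym.mul_left]
    congr 1
    exact jacobiSym.mod_left' (by rw [ZMod.val_mul]; push_cast; exact Int.emod_emod _ _)
  map_nonunit' a ha := by
    rw [jacobiSym.eq_zero_iff_not_coprime.2, Int.cast_zero]
    intro h
    refine ha ?_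
    rw [← ZMod.natCast_zmod_val a, ZMod.isUnit_iff_coprime]
    exact_mod_cast h

section
variable {R : Type*} [CommRing R] {n : ℕ} [NeZero n]

theorem jacobiCharacter_intCast (a : ℤ) :
    jacobiCharacter R n (a : ZMod n) = ((jacobiSym a n : ℤ) : R) := by
  change ((jacobiSym ((a : ZMod n).val : ℤ) n : ℤ) : R) = _
  congr 1
  exact jacobiSym.mod_left' (by rw [ZMod.val_intCast]; exact Int.emod_emod _ _)

theorem jacobiCharacter_isQuadratic : (jacobiCharacter R n).IsQuadratic := by
  intro a
  change ((jacobiSym (a.val : ℤ) n : ℤ) : R) = 0 ∨ ((jacobiSym (a.val : ℤ) n : ℤ) : R) = 1 ∨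
    ((jacobiSym (a.val : ℤ) n : ℤ) : R) = -1
  rcases jacobiSym.trichotomy (a.val : ℤ) n with h | h | h <;> rw [h] <;> simp

theorem jacobiCharacter_even (h : n ≡ 1 [MOD 4]) : (jacobiCharacter R n).Even := by
  have h1 := jacobiCharacter_intCast (R := R) (n := n) (-1)
  have hodd : Odd n := by
    rw [Nat.odd_iff]; have : n % 4 = 1 := h
    omega
  rw [jacobiSym.at_neg_one hodd, ZMod.χ₄_nat_one_mod_four h] at h1
  simpa [DirichletCharacter.Even] using h1

/-- For square-free odd `n` the Jacobi symbol does not factor through a proper divisor `d` of `n`: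
if the prime `p` divides `n / d`, then an integer that is `1` modulo `n / p` and a non-residue
modulo `p` is `1` modulo `d` and has Jacobi symbol `-1`. -/
theorem jacobiCharacter_isPrimitive [CharZero R] (hsq : Squarefree n) (hodd : Odd n) :
    (jacobiCharacter R n).IsPrimitive := by
  set χ := jacobiCharacter R n
  by_contra hne
  obtain ⟨k, hk⟩ := χ.conductor_dvd_level
  have hk1 : k ≠ 1 := by
    rintro rfl
    exact hne (by rw [mul_one] at hk; exact hk.symm)
  obtain ⟨p, hp, hpk⟩ := Nat.exists_prime_and_dvd hk1
  obtain ⟨l, rfl⟩ := hpk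
  have : Fact p.Prime := ⟨hp⟩
  have hn : n = p * (χ.conductor * l) := hk.trans (by ring)
  have hcop : Nat.Coprime p (χ.conductor * l) := by
    rw [hn] at hsq
    exact Nat.coprime_of_squarefree_mul hsq
  have hp2 : p ≠ 2 := by
    rintro rfl
    rw [hn] at hodd
    exact absurd hodd (by simp)
  obtain ⟨x, hx⟩ := FiniteField.exists_nonsquare (F := ZMod p) (by rwa [ZMod.ringChar_zmod_n])
  obtain ⟨a, ha1, ha2⟩ := Nat.chineseRemainder hcop x.val 1
  have hjp : jacobiSym (a : ℤ) p = -1 := by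
    rw [ZMod.nonsquare_iff_jacobiSym_eq_neg_one]
    rwa [Int.cast_natCast, (ZMod.natCast_eq_natCast_iff _ _ _).2 ha1, ZMod.natCast_zmod_val]
  have hjm : jacobiSym (a : ℤ) (χ.conductor * l) = 1 := by
    rw [← jacobiSym.one_left (χ.conductor * l)]
    refine jacobiSym.mod_left' ?_
    exact_mod_cast ha2
  have hj : jacobiSym (a : ℤ) n = -1 := by
    have hne0 := NeZero.ne n
    rw [hn] at hne0
    rw [hn, jacobiSym.mul_right' _ (left_ne_zero_of_mul hne0) (right_ne_zero_of_mul hne0), hjp, hjm,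
      mul_one]
  have hca : a.Coprime n := by
    by_contra h
    have := (jacobiSym.eq_zero_iff_not_coprime (a := a) (b := n)).2 (by exact_mod_cast h)
    omega
  have hker := (DirichletCharacter.factorsThrough_iff_ker_unitsMap (χ := χ)
    χ.conductor_dvd_level).1 χ.factorsThrough_conductor
  have hu : ZMod.unitOfCoprime a hca ∈ (ZMod.unitsMap χ.conductor_dvd_level).ker := by
    rw [MonoidHom.mem_ker, Units.ext_iff, ZMod.unitsMap_val, ZMod.coe_unitOfCoprime,
      ZMod.cast_natCast χ.conductor_dvd_level, Units.val_one, ← Nat.cast_one,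
      ZMod.natCast_eq_natCast_iff]
    exact ha2.of_mul_right l
  have h1 := hker hu
  rw [MonoidHom.mem_ker, Units.ext_iff, MulChar.coe_toUnitHom, ZMod.coe_unitOfCoprime,
    ← Int.cast_natCast, jacobiCharacter_intCast, hj] at h1
  have h2 : ((-1 : ℤ) : R) = ((1 : ℤ) : R) := by simpa using h1
  exact absurd (Int.cast_injective h2) (by norm_num)
end

/-! ### Gauss sums and the two factors of the cyclotomic polynomial -/

section
variable {n : ℕ} [NeZero n] {L : Type*} [Field L]

/-- The Gauss sum of a primitive quadratic character `χ` has square `χ(-1) n`. -/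
theorem gaussSum_sq_of_isPrimitive_of_isQuadratic {χ : DirichletCharacter L n}
    (hprim : χ.IsPrimitive) (hquad : χ.IsQuadratic) {e : AddChar (ZMod n) L} (he : e.IsPrimitive) :
    gaussSum χ e ^ 2 = χ (-1) * n := by
  calc gaussSum χ e ^ 2 = ∑ a, χ a * gaussSum χ e * e a := by
        rw [sq]; nth_rw 1 [gaussSum]; rw [Finset.sum_mul]
        exact Finset.sum_congr rfl fun a _ => by ring
    _ = ∑ a, ∑ b, χ b * e (a * (1 + b)) := by
        refine Finset.sum_congr rfl fun a _ => ?_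
        have h := gaussSum_mulShift_of_isPrimitive e hprim a
        rw [hquad.inv] at h
        rw [← h, gaussSum, Finset.sum_mul]
        refine Finset.sum_congr rfl fun b _ => ?_
        rw [AddChar.mulShift_apply, mul_assoc, ← AddChar.map_add_eq_mul]
        congr 2; ring
    _ = ∑ b, χ b * if 1 + b = 0 then (n : L) else 0 := by
        rw [Finset.sum_comm]
        refine Finset.sum_congr rfl fun b _ => ?_
        rw [← Finset.mul_sum, AddChar.sum_mulShift _ he, ZMod.card]
        split_ifs <;> simp
    _ = χ (-1) * n := by
        rw [Finset.sum_eq_single (-1)]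
        · simp
        · intro b _ hb
          rw [if_neg, mul_zero]
          intro h
          exact hb (by linear_combination h)
        · simp

open Classical in
/-- For a Dirichlet character `χ` and an additive character `e` modulo `n`, the product of the
`X - e a` with `χ a = ε`. The case of interest is `e a = ζ ^ a`, with `ζ` a primitive `n`-th root
of unity. -/
noncomputable def charFactor (χ : DirichletCharacter L n) (e : AddChar (ZMod n) L) (ε : L) : L[X] :=
  ∏ a with χ a = ε, (X - C (e a))

variable {χ : DirichletCharacter L n} {e : AddChar (ZMod n) L} {ε : L}

theorem charFactor_monic : (charFactor χ e ε).Monic :=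
  monic_prod_X_sub_C _ _

open Classical in
theorem natDegree_charFactor :
    (charFactor χ e ε).natDegree = (Finset.univ.filter fun a => χ a = ε).card := by
  rw [charFactor, natDegree_finsetProd_X_sub_C_eq_card]

/-- A ring homomorphism acting on the values of `e` as `e a ↦ e (u * a)` carries the factor for `ε` to
the factor for `χ u * ε`. -/
theorem map_charFactor {σ : L →+* L} {u : (ZMod n)ˣ} (hσ : ∀ a, σ (e a) = e (u * a)) :
    (charFactor χ e ε).map σ = charFactor χ e (χ u * ε) := by
  classical
  rw [charFactor, charFactor, Polynomial.map_prod]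
  have hu : χ u ≠ 0 := (u.isUnit.map χ).ne_zero
  refine Finset.prod_equiv u.mulLeft ?_ ?_
  · intro a
    simp [hu]
  · intro a _
    simp [hσ]

/-- The factors for `1` and `-1` of a nontrivial quadratic character have the same degree. -/
theorem natDegree_charFactor_neg_one [CharZero L] (hχ : χ ≠ 1) (hquad : χ.IsQuadratic) :
    (charFactor χ e (-1)).natDegree = (charFactor χ e 1).natDegree := by
  classical
  have h := MulChar.sum_eq_zero_of_ne_one hχ
  have h2 : ∀ a, χ a = (if χ a = 1 then (1 : L) else 0) - (if χ a = -1 then (1 : L) else 0) := by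
    intro a
    have : (1 : L) ≠ -1 := by norm_num
    rcases hquad a with h | h | h <;> simp [h, this, this.symm]
  rw [Finset.sum_congr rfl fun a _ => h2 a, Finset.sum_sub_distrib, Finset.sum_boole,
    Finset.sum_boole, sub_eq_zero] at h
  rw [natDegree_charFactor, natDegree_charFactor]
  exact_mod_cast h.symm

theorem charFactor_mul_charFactor [CharZero L] (hquad : χ.IsQuadratic) {ζ : L}
    (hζ : IsPrimitiveRoot ζ n) (he : ∀ a, e a = ζ ^ a.val) :
    charFactor χ e 1 * charFactor χ e (-1) = cyclotomic n L := by
  classical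
  rw [charFactor, charFactor, ← Finset.prod_union, cyclotomic_eq_prod_X_sub_primitiveRoots hζ]
  · refine Finset.prod_bij (fun a _ => ζ ^ a.val) ?_ ?_ ?_ ?_
    · intro a ha
      have : χ a ≠ 0 := by
        simp only [Finset.mem_union, Finset.mem_filter, Finset.mem_univ, true_and] at ha
        rcases ha with h | h <;> simp [h]
      have hu : IsUnit a := by
        by_contra h
        exact this (χ.map_nonunit h)
      rw [mem_primitiveRoots (NeZero.pos n)]
      refine hζ.pow_of_coprime _ ?_
      rwa [← ZMod.isUnit_iff_coprime, ZMod.natCast_zmod_val]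
    · intro a _ b _ h
      exact ZMod.val_injective n (hζ.pow_inj a.val_lt b.val_lt h)
    · intro μ hμ
      rw [mem_primitiveRoots (NeZero.pos n)] at hμ
      obtain ⟨i, hi, hc, rfl⟩ := hζ.isPrimitiveRoot_iff.1 hμ
      refine ⟨(i : ZMod n), ?_, by rw [ZMod.val_natCast, Nat.mod_eq_of_lt hi]⟩
      have : χ (i : ZMod n) ≠ 0 := (((ZMod.isUnit_iff_coprime _ _).2 hc).map χ).ne_zero
      have := (hquad (i : ZMod n)).resolve_left this
      simpa using this
    · intro a _
      rw [he]
  · rw [Finset.disjoint_left]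
    intro a h1 h2
    simp only [Finset.mem_filter, Finset.mem_univ, true_and] at h1 h2
    rw [h1] at h2
    norm_num at h2

/-- If `χ` is even, then the roots of a factor come in pairs `e a`, `e (-a)` of product `1`:
the `a` that occur are units modulo `n > 2`, so that `a ≠ -a`. -/
theorem prod_neg_roots_charFactor (hn : 2 < n) (heven : χ.Even) (hε : ε ≠ 0) :
    open Classical in ∏ a with χ a = ε, (-e a) = 1 := by
  classical
  refine Finset.prod_involution (fun a _ => -a) ?_ ?_ ?_ ?_
  · intro a _
    rw [neg_mul_neg, ← AddChar.map_add_eq_mul, add_neg_cancel, AddChar.map_zero_eq_one]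
  · intro a ha _ h
    have hu : IsUnit a := by
      by_contra h
      simp only [Finset.mem_filter, Finset.mem_univ, true_and] at ha
      exact hε (by rw [← ha, χ.map_nonunit h])
    have h2 : a * 2 = 0 := by linear_combination -h
    rw [hu.mul_right_eq_zero] at h2
    have h3 : ((2 : ℕ) : ZMod n) = 0 := by exact_mod_cast h2
    rw [ZMod.natCast_eq_zero_iff] at h3
    exact absurd (Nat.le_of_dvd (by norm_num) h3) (by omega)
  · intro a ha
    simp only [Finset.mem_filter, Finset.mem_univ, true_and] at ha ⊢
    rw [heven.eval_neg, ha]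
  · intro a _
    exact neg_neg a

theorem coeff_zero_charFactor (hn : 2 < n) (heven : χ.Even) (hε : ε ≠ 0) :
    (charFactor χ e ε).coeff 0 = 1 := by
  rw [coeff_zero_eq_eval_zero, charFactor, eval_prod, ← prod_neg_roots_charFactor (e := e) hn heven hε]
  simp

theorem reverse_charFactor (hn : 2 < n) (heven : χ.Even) (hε : ε ≠ 0) :
    (charFactor χ e ε).reverse = charFactor χ e ε := by
  classical
  have hrev : ∀ s : Finset (ZMod n), (∏ a ∈ s, (X - C (e a))).reverse =
      ∏ a ∈ s, (1 - C (e a) * X) := by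
    intro s
    induction s using Finset.induction_on with
    | empty => simpa using reverse_C (1 : L)
    | insert a s ha ih =>
      rw [Finset.prod_insert ha, Finset.prod_insert ha, reverse_mul_of_domain, ih]
      congr 1
      ext i
      rw [coeff_reverse, natDegree_X_sub_C]
      rcases i with _ | _ | i
      · simp [revAt_le]
      · simp [revAt_le, coeff_one]
      · rw [revAt_eq_self_of_lt (by omega)]
        simp [coeff_X, coeff_one]
  rw [charFactor, hrev]
  calc ∏ a with χ a = ε, (1 - C (e a) * X)
      = ∏ a with χ a = ε, (C (-e a) * (X - C (e (-a)))) := by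
        refine Finset.prod_congr rfl fun a _ => ?_
        have : C (e a) * C (e (-a)) = 1 := by
          rw [← C_mul, ← AddChar.map_add_eq_mul, add_neg_cancel, AddChar.map_zero_eq_one, C_1]
        rw [C_neg]
        linear_combination -this
    _ = ∏ a with χ a = ε, (X - C (e (-a))) := by
        rw [Finset.prod_mul_distrib, ← map_prod, prod_neg_roots_charFactor hn heven hε, C_1,
          one_mul]
    _ = ∏ a with χ a = ε, (X - C (e a)) := by
        refine Finset.prod_equiv (Equiv.neg _) ?_ ?_
        · intro a
          simp [heven.eval_neg]
        · intro a _
          simp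

theorem coeff_charFactor_symm (hn : 2 < n) (heven : χ.Even) (hε : ε ≠ 0) {i : ℕ}
    (hi : i ≤ (charFactor χ e ε).natDegree) :
    (charFactor χ e ε).coeff i =
      (charFactor χ e ε).coeff ((charFactor χ e ε).natDegree - i) := by
  conv_lhs => rw [← reverse_charFactor hn heven hε, coeff_reverse, revAt_le hi]

/-- The second highest coefficients of the two factors differ by the Gauss sum. -/
theorem coeff_charFactor_sub_charFactor [CharZero L] (hquad : χ.IsQuadratic) {N : ℕ}
    (hN : 0 < N) (h1 : (charFactor χ e 1).natDegree = N) (h2 : (charFactor χ e (-1)).natDegree = N) :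
    (charFactor χ e 1 - charFactor χ e (-1)).coeff (N - 1) = -gaussSum χ e := by
  classical
  rw [natDegree_charFactor] at h1 h2
  have e1 : (charFactor χ e 1).coeff (N - 1) = -∑ a with χ a = 1, e a := by
    conv_lhs => rw [← h1]
    exact prod_X_sub_C_coeff_card_pred _ _ (h1 ▸ hN)
  have e2 : (charFactor χ e (-1)).coeff (N - 1) = -∑ a with χ a = -1, e a := by
    conv_lhs => rw [← h2]
    exact prod_X_sub_C_coeff_card_pred _ _ (h2 ▸ hN)
  rw [coeff_sub, e1, e2, gaussSum, Finset.sum_filter, Finset.sum_filter, neg_sub_neg,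
    ← Finset.sum_sub_distrib, ← Finset.sum_neg_distrib]
  refine Finset.sum_congr rfl fun a _ => ?_
  have : (1 : L) ≠ -1 := by norm_num
  rcases hquad a with h | h | h <;> simp [h, this, this.symm]
end

/-! ### Gauss's formula -/

theorem exists_intCast_eq_of_forall_aut_apply_eq {K : Type*} [Field K] [Algebra ℚ K]
    [FiniteDimensional ℚ K] [IsGalois ℚ K] {x : K} (hint : IsIntegral ℤ x)
    (hfix : ∀ σ : Gal(K/ℚ), σ x = x) : ∃ z : ℤ, (z : K) = x := by
  obtain ⟨r, rfl⟩ := (IsGalois.mem_range_algebraMap_iff_fixed x).2 hfix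
  have hr : IsIntegral ℤ r := by
    rwa [isIntegral_algebraMap_iff (algebraMap ℚ K).injective] at hint
  obtain ⟨z, rfl⟩ := IsIntegrallyClosed.isIntegral_iff.1 hr
  exact ⟨z, by simp⟩

theorem exists_intCast_eq_of_squarefree_mul_sq {n : ℕ} (hsq : Squarefree n) {r : ℚ} {z : ℤ}
    (h : n * r ^ 2 = z) : ∃ m : ℤ, (m : ℚ) = r := by
  have hd : (r.den : ℚ) ≠ 0 := by exact_mod_cast r.den_nz
  have h1 : (n : ℤ) * r.num ^ 2 = z * (r.den : ℤ) ^ 2 := by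
    have h2 : (n : ℚ) * r.num ^ 2 = z * r.den ^ 2 := by
      rw [← h]
      nth_rw 2 [← r.num_div_den]
      field_simp
    exact_mod_cast h2
  have hcop : IsCoprime ((r.den : ℤ) ^ 2) (r.num ^ 2) := by
    refine IsCoprime.pow ?_
    rw [Int.isCoprime_iff_gcd_eq_one, Int.gcd_comm]
    exact r.reduced
  have hdvd : (r.den : ℤ) ^ 2 ∣ n := hcop.dvd_of_dvd_mul_right ⟨z, by rw [h1]; ring⟩
  have hdvd' : r.den * r.den ∣ n := by
    rw [← sq]
    exact_mod_cast hdvd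
  have := Nat.isUnit_iff.1 (hsq _ hdvd')
  exact ⟨r.num, (Rat.den_eq_one_iff r).1 this⟩

/-- The polynomial `p` has degree `d`, nonzero constant coefficient and symmetric coefficients:
it is palindromic with smallest exponent `0` and largest exponent `d`. Only `natDegree p ≤ d` is required, as equality
follows from the other two conditions. -/
structure IsPalindromeOfDegree {R : Type*} [Semiring R] (d : ℕ) (p : R[X]) : Prop where
  natDegree_le : p.natDegree ≤ d
  coeff_zero_ne : p.coeff 0 ≠ 0
  coeff_symm : ∀ i ≤ d, p.coeff i = p.coeff (d - i)

/-- Gauss's formula `4 Φ_n = A² - n q² B²`, with `A` and `B` palindromic integer polynomials of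
degrees `φ(n)/2` and `φ(n)/2 - 2`. -/
theorem exists_four_mul_cyclotomic_eq (n : ℕ) (hn : 5 ≤ n) (hsq : Squarefree n)
    (hmod : n ≡ 1 [MOD 4]) :
    ∃ A B : ℤ[X], 4 * cyclotomic n ℤ = A ^ 2 - (n : ℤ[X]) * (X * B) ^ 2 ∧
      2 ≤ n.totient / 2 ∧ IsPalindromeOfDegree (n.totient / 2) A ∧
      IsPalindromeOfDegree (n.totient / 2 - 2) B := by
  have : NeZero n := ⟨by omega⟩
  have hodd : Odd n := by
    rw [Nat.odd_iff]; have : n % 4 = 1 := hmod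
    omega
  have : NeZero (n : ℚ) := ⟨NeZero.ne _⟩
  let K := CyclotomicField n ℚ
  have : IsCyclotomicExtension {n} ℚ K := CyclotomicField.isCyclotomicExtension n ℚ
  have : IsGalois ℚ K := IsCyclotomicExtension.isGalois {n} ℚ K
  have : FiniteDimensional ℚ K := IsCyclotomicExtension.finiteDimensional {n} ℚ K
  have hζ : IsPrimitiveRoot (IsCyclotomicExtension.zeta n ℚ K) n :=
    IsCyclotomicExtension.zeta_spec n ℚ K
  set ζ := IsCyclotomicExtension.zeta n ℚ K
  set e : AddChar (ZMod n) K := AddChar.zmodChar n hζ.pow_eq_one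
  have he : ∀ a, e a = ζ ^ a.val := AddChar.zmodChar_apply _
  have heprim : e.IsPrimitive := AddChar.zmodChar_primitive_of_primitive_root n hζ
  set χ := jacobiCharacter K n
  have hprim : χ.IsPrimitive := jacobiCharacter_isPrimitive hsq hodd
  have hquad : χ.IsQuadratic := jacobiCharacter_isQuadratic
  have heven : χ.Even := jacobiCharacter_even hmod
  have hne : χ ≠ 1 := by
    intro h
    rw [DirichletCharacter.isPrimitive_def, h, DirichletCharacter.conductor_one] at hprim
    omega
  have hg : gaussSum χ e ^ 2 = n := by
    rw [gaussSum_sq_of_isPrimitive_of_isQuadratic hprim hquad heprim, heven, one_mul]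
  have hg0 : gaussSum χ e ≠ 0 := by
    intro h
    rw [h, zero_pow two_ne_zero] at hg
    exact NeZero.ne (n : K) hg.symm
  set g := gaussSum χ e
  -- `4 P Q = (P + Q)² - (P - Q)²`, where `P + Q` descends to `ℤ` and `P - Q` is `g` times an
  -- integral polynomial.
  set P := charFactor χ e 1
  set Q := charFactor χ e (-1)
  have hPQ : P * Q = cyclotomic n K := charFactor_mul_charFactor hquad hζ he
  obtain ⟨N, hPdeg⟩ : ∃ N, P.natDegree = N := ⟨_, rfl⟩
  have hQdeg : Q.natDegree = N := by rw [← hPdeg]; exact natDegree_charFactor_neg_one hne hquad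
  have hPmon : P.Monic := charFactor_monic
  have hQmon : Q.Monic := charFactor_monic
  have hN : n.totient / 2 = N := by
    rw [← natDegree_cyclotomic n K, ← hPQ, hPmon.natDegree_mul hQmon]
    omega
  have hN0 : 0 < N := by
    have h1 := natDegree_cyclotomic n K
    rw [← hPQ, hPmon.natDegree_mul hQmon, hPdeg, hQdeg] at h1
    have h2 := Nat.totient_pos.2 (NeZero.pos n)
    omega
  have hP0 : P.coeff 0 = 1 := coeff_zero_charFactor (by omega) heven one_ne_zero
  have hQ0 : Q.coeff 0 = 1 := coeff_zero_charFactor (by omega) heven (by norm_num)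
  have hPs : ∀ i ≤ N, P.coeff i = P.coeff (N - i) := fun i hi => by
    have := coeff_charFactor_symm (e := e) (i := i) (by omega : 2 < n) heven one_ne_zero
      (hi.trans_eq hPdeg.symm)
    rwa [hPdeg] at this
  have hQs : ∀ i ≤ N, Q.coeff i = Q.coeff (N - i) := fun i hi => by
    have := coeff_charFactor_symm (e := e) (ε := -1) (i := i) (by omega : 2 < n) heven
      (by norm_num) (hi.trans_eq hQdeg.symm)
    rwa [hQdeg] at this
  have hDg : (P - Q).coeff (N - 1) = -g := coeff_charFactor_sub_charFactor hquad hN0 hPdeg hQdeg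
  have hD0 : (P - Q).coeff 0 = 0 := by rw [coeff_sub, hP0, hQ0, sub_self]
  have hDs : ∀ i ≤ N, (P - Q).coeff i = (P - Q).coeff (N - i) := fun i hi => by
    rw [coeff_sub, coeff_sub, hPs i hi, hQs i hi]
  -- The coefficient of index `N - 1` is nonzero and that of index `0` is zero, so `N ≠ 1`.
  have hN2 : 2 ≤ N := by
    by_contra h
    have h1 : N = 1 := by omega
    rw [h1, Nat.sub_self, hD0] at hDg
    exact hg0 (neg_eq_zero.1 hDg.symm)
  -- The coefficients of both factors are algebraic integers.
  have heint : ∀ a, IsIntegral ℤ (e a) := fun a => by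
    rw [he]
    exact (hζ.isIntegral (NeZero.pos n)).pow _
  have hcint : ∀ ε i, IsIntegral ℤ ((charFactor χ e ε).coeff i) := by
    intro ε i
    have : charFactor χ e ε ∈ lifts (algebraMap (integralClosure ℤ K) K) := by
      refine Subsemiring.prod_mem _ fun a _ => ?_
      exact ⟨X - C ⟨e a, heint a⟩, by simp⟩
    obtain ⟨c, hc⟩ := (lifts_iff_coeff_lifts _).1 this i
    rw [← hc]
    exact c.2
  -- Every automorphism acts as `ζ ↦ ζ ^ u` for a unit `u`, and so fixes `P`, `Q` and `g`, or
  -- exchanges `P` with `Q` and negates `g`.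
  have hσ : ∀ σ : Gal(K/ℚ), ∃ u : (ZMod n)ˣ, ∀ a, (σ : K →+* K) (e a) = e (u * a) := by
    intro σ
    refine ⟨hζ.autToPow ℚ σ, fun a => ?_⟩
    have h := hζ.autToPow_spec ℚ σ
    change σ (e a) = _
    rw [he, he, map_pow, ← h, ← pow_mul, ZMod.val_mul]
    exact pow_eq_pow_mod _ hζ.pow_eq_one
  have hσg : ∀ (σ : Gal(K/ℚ)) (u : (ZMod n)ˣ), (∀ a, (σ : K →+* K) (e a) = e (u * a)) →
      (P.map (σ : K →+* K) = P ∧ Q.map (σ : K →+* K) = Q ∧ σ g = g) ∨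
      (P.map (σ : K →+* K) = Q ∧ Q.map (σ : K →+* K) = P ∧ σ g = -g) := by
    intro σ u hu
    have hmap : ∀ ε, (charFactor χ e ε).map (σ : K →+* K) = charFactor χ e (χ u * ε) :=
      fun ε => map_charFactor hu
    -- Up to sign, the Gauss sum is a coefficient of `P - Q`.
    have hcoeff : ∀ c : K[X], (c.map (σ : K →+* K)).coeff (N - 1) = σ (c.coeff (N - 1)) :=
      fun c => coeff_map _ _
    have hgD : σ g = -((P - Q).map (σ : K →+* K)).coeff (N - 1) := by
      rw [hcoeff, hDg, map_neg, neg_neg]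
    have hu0 : χ u ≠ 0 := (u.isUnit.map χ).ne_zero
    rcases (hquad u).resolve_left hu0 with h | h
    · left
      have h1 : P.map (σ : K →+* K) = P := by rw [hmap, h, one_mul]
      have h2 : Q.map (σ : K →+* K) = Q := by rw [hmap, h, one_mul]
      exact ⟨h1, h2, by rw [hgD, Polynomial.map_sub, h1, h2, hDg, neg_neg]⟩
    · right
      have h1 : P.map (σ : K →+* K) = Q := by rw [hmap, h, mul_one]
      have h2 : Q.map (σ : K →+* K) = P := by rw [hmap, h, neg_mul_neg, one_mul]
      exact ⟨h1, h2, by rw [hgD, Polynomial.map_sub, h1, h2, ← neg_sub P Q, coeff_neg, neg_neg,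
        hDg]⟩
  have hA : ∀ i, ∃ z : ℤ, (z : K) = (P + Q).coeff i := by
    intro i
    refine exists_intCast_eq_of_forall_aut_apply_eq ?_ fun σ => ?_
    · rw [coeff_add]
      exact (hcint _ _).add (hcint _ _)
    · obtain ⟨u, hu⟩ := hσ σ
      have : σ ((P + Q).coeff i) = ((P + Q).map (σ : K →+* K)).coeff i :=
        (coeff_map (σ : K →+* K) i).symm
      rw [this, Polynomial.map_add]
      rcases hσg σ u hu with ⟨h1, h2, -⟩ | ⟨h1, h2, -⟩
      · rw [h1, h2]
      · rw [h1, h2, add_comm]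
  have hB : ∀ i, ∃ z : ℤ, (z : K) = g⁻¹ * (P - Q).coeff i := by
    intro i
    have hint : IsIntegral ℤ ((P - Q).coeff i) := by
      rw [coeff_sub]
      exact (hcint _ _).sub (hcint _ _)
    have hfix : ∀ σ : Gal(K/ℚ), σ (g⁻¹ * (P - Q).coeff i) = g⁻¹ * (P - Q).coeff i := by
      intro σ
      obtain ⟨u, hu⟩ := hσ σ
      have : σ ((P - Q).coeff i) = ((P - Q).map (σ : K →+* K)).coeff i :=
        (coeff_map (σ : K →+* K) i).symm
      rw [map_mul, map_inv₀, this, Polynomial.map_sub]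
      rcases hσg σ u hu with ⟨h1, h2, h3⟩ | ⟨h1, h2, h3⟩
      · rw [h1, h2, h3]
      · rw [h1, h2, h3, ← neg_sub P Q, coeff_neg, inv_neg, neg_mul_neg]
    obtain ⟨r, hr⟩ := (IsGalois.mem_range_algebraMap_iff_fixed _).2 hfix
    -- `n r²` is the square of a coefficient of `P - Q`, so it is integral.
    have hnr : algebraMap ℚ K (n * r ^ 2) = (P - Q).coeff i ^ 2 := by
      rw [map_mul, map_pow, hr, map_natCast, ← hg, mul_pow, ← mul_assoc, ← mul_pow,
        mul_inv_cancel₀ hg0, one_pow, one_mul]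
    have hint' : IsIntegral ℤ ((n : ℚ) * r ^ 2) := by
      rw [← isIntegral_algebraMap_iff (algebraMap ℚ K).injective, hnr]
      exact hint.pow 2
    obtain ⟨z, hz⟩ := IsIntegrallyClosed.isIntegral_iff.1 hint'
    obtain ⟨m, hm⟩ := exists_intCast_eq_of_squarefree_mul_sq hsq (z := z) (by rw [← hz]; simp)
    exact ⟨m, by rw [← hr, ← hm]; simp⟩
  obtain ⟨A, hAm⟩ : P + Q ∈ lifts (Int.castRingHom K) := (lifts_iff_coeff_lifts _).2 hA
  obtain ⟨D, hDm⟩ : C g⁻¹ * (P - Q) ∈ lifts (Int.castRingHom K) :=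
    (lifts_iff_coeff_lifts _).2 fun i => by rw [coeff_C_mul]; exact hB i
  replace hAm : A.map (Int.castRingHom K) = P + Q := hAm
  replace hDm : D.map (Int.castRingHom K) = C g⁻¹ * (P - Q) := hDm
  have hAc : ∀ i, (A.coeff i : K) = P.coeff i + Q.coeff i := fun i => by
    rw [← coeff_add, ← hAm, coeff_map]; rfl
  have hDc : ∀ i, (D.coeff i : K) = g⁻¹ * (P - Q).coeff i := fun i => by
    rw [← coeff_C_mul, ← hDm, coeff_map]; rfl
  have hinj : Function.Injective (Int.cast : ℤ → K) := Int.cast_injective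
  have hDsymm : ∀ i ≤ N, D.coeff i = D.coeff (N - i) := fun i hi =>
    hinj (by rw [hDc, hDc, hDs i hi])
  have hDzero : D.coeff 0 = 0 := hinj (by rw [hDc, hD0, mul_zero, Int.cast_zero])
  have hDX : X * D.divX = D := by
    conv_rhs => rw [← X_mul_divX_add D, hDzero, C_0, add_zero]
  have hDdeg : D.natDegree ≤ N - 1 := by
    rw [natDegree_le_iff_coeff_eq_zero]
    intro i hi
    rcases (by omega : i = N ∨ N < i) with rfl | h
    · rw [hDsymm _ le_rfl, Nat.sub_self, hDzero]
    · refine hinj ?_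
      rw [hDc, coeff_sub, coeff_eq_zero_of_natDegree_lt (hPdeg.trans_lt h),
        coeff_eq_zero_of_natDegree_lt (hQdeg.trans_lt h)]
      simp
  rw [hN]
  refine ⟨A, D.divX, ?_, hN2, ⟨?_, ?_, ?_⟩, ⟨?_, ?_, ?_⟩⟩
  · have hCg : (C g * C g⁻¹ : K[X]) = 1 := by rw [← C_mul, mul_inv_cancel₀ hg0, C_1]
    refine map_injective (Int.castRingHom K) hinj ?_
    rw [hDX, Polynomial.map_mul, map_cyclotomic_int, Polynomial.map_sub, Polynomial.map_mul,
      Polynomial.map_pow, Polynomial.map_pow, hAm, hDm, ← hPQ, Polynomial.map_natCast,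
      ← map_natCast (C : K →+* K[X]) n, ← hg, C_pow, Polynomial.map_ofNat]
    linear_combination (C g * C g⁻¹ + 1) * (P - Q) ^ 2 * hCg
  · rw [natDegree_le_iff_coeff_eq_zero]
    intro i h
    refine hinj ?_
    rw [hAc, coeff_eq_zero_of_natDegree_lt (hPdeg.trans_lt h),
        coeff_eq_zero_of_natDegree_lt (hQdeg.trans_lt h)]
    simp
  · intro h
    have := hAc 0
    rw [h, hP0, hQ0] at this
    norm_num at this
  · exact fun i hi => hinj (by rw [hAc, hAc, hPs i hi, hQs i hi])
  · rw [natDegree_divX_eq_natDegree_tsub_one]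
    omega
  · rw [coeff_divX, hDsymm _ (by omega)]
    intro h
    have := hDc (N - 1)
    rw [hDg, mul_neg, inv_mul_cancel₀ hg0, h] at this
    norm_num at this
  · intro i hi
    rw [coeff_divX, coeff_divX, hDsymm _ (by omega)]
    congr 1
    omega

/-! ### The Gamma map -/

namespace LucasAtoms

/-- The polynomial `∑_j γ_j s^{d-2j} (-t)^j` with prescribed gamma coefficients. -/
noncomputable def gammaForm {R : Type*} [CommRing R] (d : ℕ) (γ : ℕ → R) :
    MvPolynomial (Fin 2) R :=
  ∑ j ∈ Finset.range (d / 2 + 1), MvPolynomial.C (γ j) *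
    (MvPolynomial.X 0 ^ (d - 2 * j) * (-MvPolynomial.X 1) ^ j)

theorem gammaMap_eq_gammaForm (p : ℂ[X]) : gammaMap p = gammaForm (tdeg p) (gammaCoeff p) := rfl

theorem map_gammaForm {R S : Type*} [CommRing R] [CommRing S] (f : R →+* S) (d : ℕ) (γ : ℕ → R) :
    MvPolynomial.map f (gammaForm d γ) = gammaForm d (fun j => f (γ j)) := by
  simp [gammaForm]

theorem gammaForm_eq_sum_monomial {R : Type*} [CommRing R] (d : ℕ) (γ : ℕ → R) :
    gammaForm d γ = ∑ j ∈ Finset.range (d / 2 + 1), MvPolynomial.monomial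
      (Finsupp.single 0 (d - 2 * j) + Finsupp.single 1 j) (γ j * (-1) ^ j) := by
  refine Finset.sum_congr rfl fun j _ => ?_
  rw [neg_pow, ← map_one MvPolynomial.C, ← map_neg, ← map_pow,
    mul_left_comm (MvPolynomial.X 0 ^ (d - 2 * j)), ← mul_assoc, ← map_mul, MvPolynomial.X_pow_eq_monomial, MvPolynomial.X_pow_eq_monomial,
    MvPolynomial.monomial_mul, MvPolynomial.C_mul_monomial, mul_one, mul_one, mul_comm]

theorem coeff_gammaForm {R : Type*} [CommRing R] (d : ℕ) (γ : ℕ → R) :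
    (gammaForm d γ).coeff (Finsupp.single 0 d) = γ 0 := by
  rw [gammaForm_eq_sum_monomial, MvPolynomial.coeff_sum, Finset.sum_eq_single 0]
  · simp
  · intro j _ hj
    rw [MvPolynomial.coeff_monomial, if_neg]
    intro h
    have := DFunLike.congr_fun h 1
    simp at this
    exact hj this
  · simp

theorem gammaForm_ne_zero {R : Type*} [CommRing R] {d : ℕ} {γ : ℕ → R} (h : γ 0 ≠ 0) :
    gammaForm d γ ≠ 0 := by
  intro h0
  rw [← coeff_gammaForm d γ, h0] at h
  exact h (MvPolynomial.coeff_zero _)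

theorem sdeg_gammaForm {R : Type*} [CommRing R] {d : ℕ} {γ : ℕ → R} (h : γ 0 ≠ 0) :
    sdeg (gammaForm d γ) = d := by
  refine le_antisymm ?_ ?_
  · rw [sdeg, gammaForm_eq_sum_monomial]
    refine (MvPolynomial.degreeOf_sum_le _ _ _).trans (Finset.sup_le fun j _ => ?_)
    refine MvPolynomial.degreeOf_le_iff.2 fun m hm => ?_
    rw [Finset.mem_singleton.1 (MvPolynomial.support_monomial_subset hm)]
    simp
  · have := MvPolynomial.monomial_le_degreeOf 0 (f := gammaForm d γ) (m := Finsupp.single 0 d)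
      (by rwa [MvPolynomial.mem_support_iff, coeff_gammaForm])
    simpa [sdeg] using this

/-- With `s = x (1 + q)` and `t = -x² q` the value of `Γ(p)` is `x^d p(q)`. -/
theorem eval_gammaMap {p : ℂ[X]} (hp : IsPalindromic p) (x q : ℂ) :
    MvPolynomial.eval ![x * (1 + q), -(x ^ 2 * q)] (gammaMap p) = x ^ tdeg p * p.eval q := by
  rw [congrArg (eval q) (gamma_expansion p hp), gammaMap, map_sum, eval_finsetSum, Finset.mul_sum]
  refine Finset.sum_congr rfl fun j hj => ?_
  have hj' := Finset.mem_range.1 hj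
  have hx : x ^ tdeg p = x ^ (tdeg p - 2 * j) * x ^ (2 * j) := by rw [← pow_add]; congr 1; omega
  rw [hx]
  simp [mul_pow, ← pow_mul]
  ring

/-- A polynomial in `s` and `t` is determined by its values at the points
`(x (1 + q), -x² q)`: a point `(s, t)` with `t ≠ 0` is of this form, with `x` and `x q` the roots
of `z² - s z - t`. -/
theorem eq_of_eval_eq {f g : MvPolynomial (Fin 2) ℂ}
    (h : ∀ x q : ℂ, MvPolynomial.eval ![x * (1 + q), -(x ^ 2 * q)] f =
      MvPolynomial.eval ![x * (1 + q), -(x ^ 2 * q)] g) : f = g := by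
  have hX : (MvPolynomial.X 1 : MvPolynomial (Fin 2) ℂ) ≠ 0 := MvPolynomial.X_ne_zero 1
  refine mul_left_cancel₀ hX (MvPolynomial.funext fun v => ?_)
  rw [map_mul, map_mul, MvPolynomial.eval_X]
  by_cases ht : v 1 = 0
  · rw [ht, zero_mul, zero_mul]
  obtain ⟨w, hw⟩ := IsAlgClosed.exists_pow_nat_eq (v 0 ^ 2 + 4 * v 1) two_pos
  obtain ⟨x, hx⟩ : ∃ x, x = (v 0 + w) / 2 := ⟨_, rfl⟩
  have hroot : x * (v 0 - x) = -v 1 := by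
    rw [hx]
    linear_combination (-1 / 4 : ℂ) * hw
  have hx0 : x ≠ 0 := by
    rintro h0
    rw [h0, zero_mul] at hroot
    exact ht (neg_eq_zero.1 hroot.symm)
  have hv : v = ![x * (1 + (v 0 - x) / x), -(x ^ 2 * ((v 0 - x) / x))] := by
    funext i
    fin_cases i
    · simp
      field_simp
      ring
    · simp
      field_simp
      linear_combination hroot
  have := h x ((v 0 - x) / x)
  rw [← hv] at this
  rw [this]

theorem gammaCoeff_map_intCast_mem_range (p : ℤ[X]) (j : ℕ) :
    gammaCoeff (p.map (Int.castRingHom ℂ)) j ∈ (Int.castRingHom ℂ).range := by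
  induction j using Nat.strong_induction_on with
  | _ j ih =>
    rw [gammaCoeff, coeff_map]
    exact sub_mem ⟨_, rfl⟩ (sum_mem fun i _ => mul_mem (ih i i.2) (natCast_mem _ _))

theorem tdeg_eq_natDegree {p : ℂ[X]} (h : p.coeff 0 ≠ 0) : tdeg p = p.natDegree := by
  rw [tdeg, natTrailingDegree_eq_zero.2 (Or.inr h), add_zero]

end LucasAtoms

open LucasAtoms

section
variable {d : ℕ} {p : ℤ[X]}

theorem IsPalindromeOfDegree.tdeg_map (h : IsPalindromeOfDegree d p) :
    tdeg (p.map (Int.castRingHom ℂ)) = d := by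
  have hd : p.natDegree = d := le_antisymm h.natDegree_le <| le_natDegree_of_ne_zero <| by
    rw [h.coeff_symm d le_rfl, Nat.sub_self]
    exact h.coeff_zero_ne
  rw [tdeg_eq_natDegree, natDegree_map_eq_of_injective (RingHom.injective_int _), hd]
  rw [coeff_map]
  exact Int.cast_ne_zero.2 h.coeff_zero_ne

theorem IsPalindromeOfDegree.isPalindromic_map (h : IsPalindromeOfDegree d p) :
    IsPalindromic (p.map (Int.castRingHom ℂ)) := by
  intro i hi
  rw [h.tdeg_map] at hi ⊢
  rw [coeff_map, coeff_map, h.coeff_symm i hi]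

/-- The image under `Γ` of an integral palindromic polynomial is integral, and its degree in `s`
is the degree of the polynomial. -/
theorem IsPalindromeOfDegree.exists_gammaMap_eq (h : IsPalindromeOfDegree d p) :
    ∃ E : MvPolynomial (Fin 2) ℤ,
      MvPolynomial.map (Int.castRingHom ℂ) E = gammaMap (p.map (Int.castRingHom ℂ)) ∧
        E ≠ 0 ∧ sdeg E = d := by
  choose γ hγ using gammaCoeff_map_intCast_mem_range p
  have h0 : γ 0 ≠ 0 := by
    intro h1
    have h2 := hγ 0
    rw [h1, gammaCoeff, coeff_map] at h2
    simp only [map_zero, Finset.univ_eq_empty, Finset.sum_empty, sub_zero] at h2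
    exact h.coeff_zero_ne (RingHom.injective_int (Int.castRingHom ℂ) (by rw [map_zero, h2]))
  refine ⟨gammaForm d γ, ?_, gammaForm_ne_zero h0, sdeg_gammaForm h0⟩
  rw [map_gammaForm, gammaMap_eq_gammaForm, h.tdeg_map]
  simp_rw [hγ]
end

theorem theorem4p4 (n : ℕ) (hn : 5 ≤ n) (hsq : Squarefree n) (hmod : n ≡ 1 [MOD 4]) :
    ∃ E F : MvPolynomial (Fin 2) ℤ,
      4 * LucasAtoms.lucasAtom n =
        (MvPolynomial.map (Int.castRingHom ℂ) E) ^ 2 -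
          (n : MvPolynomial (Fin 2) ℂ) * (MvPolynomial.X 1) ^ 2 *
            (MvPolynomial.map (Int.castRingHom ℂ) F) ^ 2 ∧
      E ≠ 0 ∧ LucasAtoms.sdeg E = n.totient / 2 ∧
      F ≠ 0 ∧ LucasAtoms.sdeg F + 2 = n.totient / 2 := by
  obtain ⟨A, B, hAB, hN, hA, hB⟩ := exists_four_mul_cyclotomic_eq n hn hsq hmod
  obtain ⟨E, hE, hE0, hEd⟩ := hA.exists_gammaMap_eq
  obtain ⟨F, hF, hF0, hFd⟩ := hB.exists_gammaMap_eq
  refine ⟨E, F, ?_, hE0, hEd, hF0, by omega⟩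
  rw [hE, hF, lucasAtom, if_neg (by omega)]
  have hdeg : tdeg (cyclotomic n ℂ) = 2 * (n.totient / 2) := by
    rw [tdeg_eq_natDegree, natDegree_cyclotomic]
    · have := (Nat.totient_even (by omega : 2 < n)).two_dvd
      omega
    · rw [cyclotomic_coeff_zero ℂ (by omega)]
      exact one_ne_zero
  refine eq_of_eval_eq fun x q => ?_
  have hq := congrArg (fun p : ℤ[X] => (p.map (Int.castRingHom ℂ)).eval q) hAB
  simp only [Polynomial.map_mul, Polynomial.map_sub, Polynomial.map_pow, map_cyclotomic_int,
    Polynomial.map_natCast, Polynomial.map_ofNat, map_X, eval_mul, eval_sub, eval_pow, eval_X,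
    eval_natCast, eval_ofNat] at hq
  simp only [map_mul, map_sub, map_pow, map_ofNat, map_natCast, MvPolynomial.eval_X]
  rw [eval_gammaMap (isPalindromic_cyclotomic n (by omega)), eval_gammaMap hA.isPalindromic_map,
    eval_gammaMap hB.isPalindromic_map, hA.tdeg_map, hB.tdeg_map, hdeg]
  obtain ⟨k, hk⟩ := Nat.exists_eq_add_of_le hN
  rw [hk, Nat.add_sub_cancel_left]
  simp only [Matrix.cons_val_one, Matrix.cons_val_fin_one]
  linear_combination x ^ (2 * (2 + k)) * hq
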